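/- Let $K$ be a commutative ring. Let ${\mathcal H}_{NCK}$ be the free $K$-module with basis $Y_F$ indexed by plane forests $F$, and let $|F|$ be the number of nodes of $F$. Label the nodes of a forest $F$ with $n$ nodes by $1,\dots,n$ in postorder, and write $i<_F j$ if node $i$ is a proper descendant of node $j$ (so roots are maximal). The coproduct of ${\mathcal H}_{NCK}$ is $$\Delta Y_F=\sum_{u} Y_{F_{(1)}}\otimes Y_{F_{(2)}},$$ where $u$ runs over the words $u\in\{1,2\}^n$ such that $i<_Fj\Rightarrow u_i\le u_j$, and $F_{(k)}$ is the restriction of $F$ to the nodes $i$ with $u_i=k$; its counit is $\varepsilon(Y_F)=\delta_{F,\emptyset}$. Let ${\mathcal H}_{NCK}^*$ be the graded dual, with basis $X_F$ dual to $Y_F$ and with the product dual to $\Delta$, that is, $\langle Y_F,ab\rangle=\langle\Delta Y_F,a\otimes b\rangle$. Let ${\bf Sym}=K\langle S_1,S_2,\dots\rangle$ be the free associative algebra of noncommutative symmetric functions. For a composition $I=(i_1,\dots,i_r)$ write $\ell(I)=r$, $S^I=S_{i_1}\cdots S_{i_r}$, and let $$R_I=\sum_{J}(-1)^{\ell(I)-\ell(J)}S^J$$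 be the ribbon Schur function, where $J$ runs over the compositions that are equal to or coarser than $I$. Proposition. The algebra morphism $\iota:{\bf Sym}\to{\mathcal H}_{NCK}^*$ defined by $\iota(S_n)=\sum_{|F|=n}X_F$ for $n\ge1$ is injective. For every composition $I$ and every plane forest $F$, the coefficient of $X_F$ in $\iota(R_I)$ is equal (in $K$) to the number of linear extensions of $F$ of ribbon shape $I$. Here a linear extension of $F$ is a permutation $\sigma$ of $\{1,\dots,n\}$, $n=|F|$, such that $i<_Fj\Rightarrow\sigma^{-1}(i)<\sigma^{-1}(j)$, and its ribbon shape is its descent composition: the composition of $n$ whose proper nonempty partial sums are exactly the positions $k$, $1\le k<n$, with $\sigma(k)>\sigma(k+1)$. (In particular the coefficient is $0$ if $I$ is not a composition of $|F|$.) -/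

import Mathlib

open scoped TensorProduct BigOperators

noncomputable section

/-- Plane forests: a forest is either empty, or an ordered sequence of plane trees whose first
tree has a root above the forest `C` of its subtrees, and whose remaining trees form the
forest `R`; thus `graft C R` is `B₊(C) R`. -/
inductive PlaneForest : Type
  | empty : PlaneForest
  | graft (C R : PlaneForest) : PlaneForest

namespace PlaneForest

/-- Concatenation of forests. -/
def append : PlaneForest → PlaneForest → PlaneForest
  | empty, G => G
  | graft C R, G => graft C (append R G)

/-- The number of nodes `|F|`. -/
def size : PlaneForest → ℕ
  | empty => 0
  | graft C R => C.size + 1 + R.size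

/-! The canonical labelling is the postorder one. The nodes of `F` are identified with their
labels, which are numbered from `0`, so that the node set of `F` is `Fin F.size`. In `graft C R`
the nodes of `C` come first, then the root of the first tree, then the nodes of `R`. -/

/-- A node of `C`, as a node of `graft C R`. -/
def inSub (C R : PlaneForest) (i : Fin C.size) : Fin (graft C R).size :=
  Fin.castAdd R.size (Fin.castAdd 1 i)

/-- The root of the first tree of `graft C R`. -/
def firstRoot (C R : PlaneForest) : Fin (graft C R).size :=
  Fin.castAdd R.size (Fin.natAdd C.size (0 : Fin 1))

/-- A node of `R`, as a node of `graft C R`. -/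
def inRest (C R : PlaneForest) (i : Fin R.size) : Fin (graft C R).size :=
  Fin.natAdd (C.size + 1) i

/-- The strict order `i <_F j` of the forest poset: `i` is a proper descendant of `j`
(roots are maximal). -/
inductive Below : (F : PlaneForest) → Fin F.size → Fin F.size → Prop
  | root (C R : PlaneForest) (i : Fin C.size) : Below (graft C R) (inSub C R i) (firstRoot C R)
  | sub (C R : PlaneForest) (i j : Fin C.size) (h : Below C i j) :
      Below (graft C R) (inSub C R i) (inSub C R j)
  | rest (C R : PlaneForest) (i j : Fin R.size) (h : Below R i j) :
      Below (graft C R) (inRest C R i) (inRest C R j)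

/-- The labellings `u` of the nodes of `F` that are nondecreasing from bottom to top:
`i <_F j ⇒ u i ≤ u j`. -/
def IsNondecreasing {α : Type} [Preorder α] (F : PlaneForest) (u : Fin F.size → α) : Prop :=
  ∀ i j, F.Below i j → u i ≤ u j

/-- The restriction of the plane forest `F` to the nodes labelled `a` by `u` (with the induced
descendant relation and the induced plane order). -/
def part {α : Type} [DecidableEq α] : (F : PlaneForest) → (Fin F.size → α) → α → PlaneForest
  | empty, _, _ => empty
  | graft C R, u, a =>
      if u (firstRoot C R) = a then
        graft (C.part (fun i => u (inSub C R i)) a) (R.part (fun i => u (inRest C R i)) a)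
      else
        (C.part (fun i => u (inSub C R i)) a).append (R.part (fun i => u (inRest C R i)) a)

open Classical in
/-- The nondecreasing labellings of `F` by the two letters `0 < 1` (the admissible cuts of `F`). -/
def cuts (F : PlaneForest) : Finset (Fin F.size → Fin 2) :=
  Finset.univ.filter fun u => F.IsNondecreasing u

/-- Linear extensions of `F`, as permutations `σ` read as words `σ 0, σ 1, …, σ (n-1)` in the
labels of the nodes: if `i <_F j` then `i` is to the left of `j`. -/
def IsLinearExtension (F : PlaneForest) (σ : Equiv.Perm (Fin F.size)) : Prop :=
  ∀ i j, F.Below i j → σ⁻¹ i < σ⁻¹ j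

/-! ### Facts about cuts, needed for the coalgebra structure -/

/-- Sum of a function over the pairs (lower part, upper part) of all admissible cuts,
computed recursively. -/
def cutSum {M : Type*} [AddCommMonoid M] :
    PlaneForest → (PlaneForest → PlaneForest → M) → M
  | empty, f => f empty empty
  | graft C R, f =>
      R.cutSum (fun P Q => f (graft C P) Q) +
      C.cutSum (fun P₁ Q₁ => R.cutSum (fun P₂ Q₂ => f (P₁.append P₂) (graft Q₁ Q₂)))

theorem append_empty (F : PlaneForest) : F.append empty = F := by
  induction F with
  | empty => rfl
  | graft C R _ ih => simp [append, ih]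

theorem append_assoc (F G H : PlaneForest) :
    (F.append G).append H = F.append (G.append H) := by
  induction F with
  | empty => rfl
  | graft C R _ ih => simp [append, ih]

theorem size_append (F G : PlaneForest) : (F.append G).size = F.size + G.size := by
  induction F with
  | empty => simp [append, size]
  | graft C R _ ih => simp [append, size, ih]; omega

section cutSum
variable {M : Type*} [AddCommMonoid M]

theorem cutSum_add (F : PlaneForest) (f g : PlaneForest → PlaneForest → M) :
    F.cutSum (fun P Q => f P Q + g P Q) = F.cutSum f + F.cutSum g := by
  induction F generalizing f g with
  | empty => rfl
  | graft C R ihC ihR => simp only [cutSum, ihC, ihR]; abel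

theorem cutSum_zero (F : PlaneForest) : F.cutSum (fun _ _ => (0 : M)) = 0 := by
  induction F with
  | empty => rfl
  | graft C R ihC ihR => simp only [cutSum, ihC, ihR, add_zero]

theorem cutSum_map {N : Type*} [AddCommMonoid N] (φ : M →+ N) (F : PlaneForest)
    (f : PlaneForest → PlaneForest → M) :
    φ (F.cutSum f) = F.cutSum (fun P Q => φ (f P Q)) := by
  induction F generalizing f with
  | empty => rfl
  | graft C R ihC ihR => simp only [cutSum, map_add, ihC, ihR]

theorem cutSum_comm (F G : PlaneForest)
    (f : PlaneForest → PlaneForest → PlaneForest → PlaneForest → M) :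
    F.cutSum (fun A B => G.cutSum (fun C D => f A B C D)) =
      G.cutSum (fun C D => F.cutSum (fun A B => f A B C D)) := by
  induction F generalizing f with
  | empty => rfl
  | graft C R ihC ihR =>
    simp only [cutSum, cutSum_add]
    rw [ihR]
    simp_rw [ihR, ihC]

theorem cutSum_append (F G : PlaneForest) (f : PlaneForest → PlaneForest → M) :
    (F.append G).cutSum f =
      F.cutSum (fun P₁ Q₁ => G.cutSum (fun P₂ Q₂ => f (P₁.append P₂) (Q₁.append Q₂))) := by
  induction F generalizing f with
  | empty => rfl
  | graft C R _ ih => simp only [append, cutSum, ih, append_assoc]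

theorem cutSum_coassoc (F : PlaneForest) (f : PlaneForest → PlaneForest → PlaneForest → M) :
    F.cutSum (fun P Q => P.cutSum (fun A B => f A B Q)) =
      F.cutSum (fun A Q => Q.cutSum (fun B D => f A B D)) := by
  induction F generalizing f with
  | empty => rfl
  | graft C R ihC ihR =>
    simp only [cutSum, cutSum_add, cutSum_append]
    rw [add_assoc]
    congr 1
    · exact ihR (fun A B D => f (graft C A) B D)
    · congr 1
      · rw [cutSum_comm]
        congr 1
        funext A₁ B₁
        exact ihR (fun A B D => f (A₁.append A) (graft B₁ B) D)
      · calc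
          _ = C.cutSum (fun P₁ Q₁ => P₁.cutSum (fun A₁ B₁ => R.cutSum (fun P₂ Q₂ =>
                P₂.cutSum (fun A₂ B₂ =>
                  f (A₁.append A₂) (B₁.append B₂) (graft Q₁ Q₂))))) := by
              congr 1; funext P₁ Q₁; rw [cutSum_comm]
          _ = C.cutSum (fun P₁ Q₁ => P₁.cutSum (fun A₁ B₁ => R.cutSum (fun A₂ Q₂ =>
                Q₂.cutSum (fun B₂ D₂ =>
                  f (A₁.append A₂) (B₁.append B₂) (graft Q₁ D₂))))) := by
              congr 1; funext P₁ Q₁; congr 1; funext A₁ B₁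
              exact ihR (fun A B D => f (A₁.append A) (B₁.append B) (graft Q₁ D))
          _ = C.cutSum (fun A₁ Q₁ => Q₁.cutSum (fun B₁ D₁ => R.cutSum (fun A₂ Q₂ =>
                Q₂.cutSum (fun B₂ D₂ =>
                  f (A₁.append A₂) (B₁.append B₂) (graft D₁ D₂))))) :=
              ihC (fun A₁ B₁ Q₁ => R.cutSum (fun A₂ Q₂ => Q₂.cutSum (fun B₂ D₂ =>
                  f (A₁.append A₂) (B₁.append B₂) (graft Q₁ D₂))))
          _ = _ := by
              congr 1; funext A₁ Q₁; rw [cutSum_comm]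

theorem cutSum_congr_size (F : PlaneForest) (f g : PlaneForest → PlaneForest → M)
    (h : ∀ P Q, P.size + Q.size = F.size → f P Q = g P Q) : F.cutSum f = F.cutSum g := by
  induction F generalizing f g with
  | empty => exact h _ _ rfl
  | graft C R ihC ihR =>
    simp only [cutSum]
    congr 1
    · refine ihR _ _ fun P Q hs => h _ _ ?_
      simp only [size]; omega
    · refine ihC _ _ fun P₁ Q₁ h₁ => ihR _ _ fun P₂ Q₂ h₂ => h _ _ ?_
      simp only [size, size_append]; omega

/-- Cutting off nothing is the only cut whose lower part is empty, and dually. -/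
theorem cutSum_left (F : PlaneForest) (f : PlaneForest → PlaneForest → M)
    (h : ∀ P Q, P ≠ empty → f P Q = 0) : F.cutSum f = f empty F := by
  induction F generalizing f with
  | empty => rfl
  | graft C R ihC ihR =>
    simp only [cutSum]
    have h1 : R.cutSum (fun P Q => f (graft C P) Q) = 0 := by
      rw [← cutSum_zero (M := M) R]
      congr 1; funext P Q; exact h _ _ (by simp)
    rw [h1, zero_add, ihC, ihR]
    · rfl
    · intro P Q hP; exact h _ _ (by simpa [append] using hP)
    · intro P Q hP
      rw [← cutSum_zero (M := M) R]
      congr 1; funext P₂ Q₂; apply h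
      cases P with
      | empty => exact absurd rfl hP
      | graft _ _ => simp [append]

theorem cutSum_right (F : PlaneForest) (f : PlaneForest → PlaneForest → M)
    (h : ∀ P Q, Q ≠ empty → f P Q = 0) : F.cutSum f = f F empty := by
  induction F generalizing f with
  | empty => rfl
  | graft C R ihC ihR =>
    simp only [cutSum]
    have h1 : C.cutSum (fun P₁ Q₁ => R.cutSum
        (fun P₂ Q₂ => f (P₁.append P₂) (graft Q₁ Q₂))) = 0 := by
      rw [← cutSum_zero (M := M) C]
      congr 1; funext P Q
      rw [← cutSum_zero (M := M) R]
      congr 1; funext P' Q'; exact h _ _ (by simp)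
    rw [h1, add_zero, ihR]
    intro P Q hQ; exact h _ _ hQ

end cutSum

theorem part_const {α : Type} [DecidableEq α] (F : PlaneForest) (a b : α) :
    F.part (fun _ => a) b = if a = b then F else empty := by
  induction F with
  | empty => simp [part]
  | graft C R ihC ihR =>
    simp only [part, ihC, ihR]
    split <;> rfl

/-- A labelling of `graft C R` is a triple of labellings. -/
def glue (C R : PlaneForest) {α : Type} :
    ((Fin C.size → α) × (Fin 1 → α)) × (Fin R.size → α) ≃ (Fin (graft C R).size → α) :=
  (Equiv.prodCongr (Fin.appendEquiv C.size 1) (Equiv.refl _)).trans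
    (Fin.appendEquiv (C.size + 1) R.size)

section glue
variable {α : Type} (C R : PlaneForest) (a : Fin C.size → α) (x : Fin 1 → α) (b : Fin R.size → α)

theorem glue_inSub (i : Fin C.size) : glue C R ((a, x), b) (inSub C R i) = a i := by
  change Fin.append (Fin.append a x) b (Fin.castAdd R.size (Fin.castAdd 1 i)) = a i
  rw [Fin.append_left, Fin.append_left]

theorem glue_firstRoot : glue C R ((a, x), b) (firstRoot C R) = x 0 := by
  change Fin.append (Fin.append a x) b (Fin.castAdd R.size (Fin.natAdd C.size 0)) = x 0
  rw [Fin.append_left, Fin.append_right]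

theorem glue_inRest (i : Fin R.size) : glue C R ((a, x), b) (inRest C R i) = b i := by
  change Fin.append (Fin.append a x) b (Fin.natAdd (C.size + 1) i) = b i
  rw [Fin.append_right]

end glue

theorem isNondecreasing_graft {α : Type} [Preorder α] (C R : PlaneForest)
    (u : Fin (graft C R).size → α) :
    (graft C R).IsNondecreasing u ↔
      C.IsNondecreasing (fun i => u (inSub C R i)) ∧
      R.IsNondecreasing (fun i => u (inRest C R i)) ∧
      ∀ i, u (inSub C R i) ≤ u (firstRoot C R) := by
  constructor
  · intro h
    exact ⟨fun i j hij => h _ _ (.sub C R i j hij), fun i j hij => h _ _ (.rest C R i j hij),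
      fun i => h _ _ (.root C R i)⟩
  · rintro ⟨h1, h2, h3⟩ i j hij
    cases hij with
    | root _ _ i => exact h3 i
    | sub _ _ i j h => exact h1 i j h
    | rest _ _ i j h => exact h2 i j h

open Classical in
theorem sum_cuts {M : Type*} [AddCommMonoid M] (F : PlaneForest)
    (f : PlaneForest → PlaneForest → M) :
    ∑ u ∈ F.cuts, f (F.part u 0) (F.part u 1) = F.cutSum f := by
  induction F generalizing f with
  | empty =>
    have : (empty.cuts) = Finset.univ := by
      ext u
      simp only [cuts, Finset.mem_filter, Finset.mem_univ, true_and, iff_true]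
      intro i; exact Fin.elim0 i
    rw [this]
    change ∑ u : Fin 0 → Fin 2, f empty empty = f empty empty
    simp
  | graft C R ihC ihR =>
    have hR : ∀ (g : PlaneForest → PlaneForest → M),
        ∑ b : Fin R.size → Fin 2,
          (if R.IsNondecreasing b then g (R.part b 0) (R.part b 1) else 0) = R.cutSum g := by
      intro g; rw [← ihR g, cuts, Finset.sum_filter]
    have hC : ∀ (g : PlaneForest → PlaneForest → M),
        ∑ b : Fin C.size → Fin 2,
          (if C.IsNondecreasing b then g (C.part b 0) (C.part b 1) else 0) = C.cutSum g := by
      intro g; rw [← ihC g, cuts, Finset.sum_filter]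
    rw [cuts, Finset.sum_filter, ← (glue C R).sum_comp, Fintype.sum_prod_type,
      Fintype.sum_prod_type]
    simp only [isNondecreasing_graft, glue_inSub, glue_firstRoot, glue_inRest, part]
    rw [Finset.sum_comm, ← (Equiv.funUnique (Fin 1) (Fin 2)).symm.sum_comp, Fin.sum_univ_two]
    have e : ∀ y : Fin 2, (Equiv.funUnique (Fin 1) (Fin 2)).symm y 0 = y := fun y => rfl
    simp only [e, cutSum]
    congr 1
    · rw [Finset.sum_eq_single (fun _ => 0)]
      · have h0 : C.IsNondecreasing (fun _ => (0 : Fin 2)) := fun _ _ _ => le_rfl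
        rw [← hR]
        refine Finset.sum_congr rfl fun b _ => ?_
        simp [h0, part_const, append]
      · intro a _ ha
        refine Finset.sum_eq_zero fun b _ => if_neg ?_
        rintro ⟨-, -, h⟩
        exact ha (funext fun i => Fin.le_zero_iff.mp (h i))
      · intro h; exact absurd (Finset.mem_univ _) h
    · rw [← hC]
      refine Finset.sum_congr rfl fun a _ => ?_
      by_cases ha : C.IsNondecreasing a
      · rw [if_pos ha, ← hR]
        refine Finset.sum_congr rfl fun b _ => ?_
        have hle : ∀ i, a i ≤ 1 := fun i => Fin.le_last (a i)
        simp [ha, hle]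
      · rw [if_neg ha]
        refine Finset.sum_eq_zero fun b _ => if_neg ?_
        rintro ⟨h, -⟩; exact ha h

theorem finite_size_le (n : ℕ) : {F : PlaneForest | F.size ≤ n}.Finite := by
  induction n with
  | zero =>
    refine (Set.finite_singleton empty).subset fun F hF => ?_
    cases F with
    | empty => rfl
    | graft C R => simp [size] at hF
  | succ n ih =>
    refine ((Set.finite_singleton empty).union
      (Set.Finite.image2 graft ih ih)).subset fun F hF => ?_
    cases F with
    | empty => exact Or.inl rfl
    | graft C R =>
      simp only [Set.mem_ofPred_eq, size] at hF
      exact Or.inr ⟨C, by simp only [Set.mem_ofPred_eq]; omega, R,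
        by simp only [Set.mem_ofPred_eq]; omega, rfl⟩

theorem finite_size_eq (n : ℕ) : {F : PlaneForest | F.size = n}.Finite :=
  (finite_size_le n).subset fun _ hF => le_of_eq hF

/-- The finite set of plane forests with `n` nodes. -/
def ofSize (n : ℕ) : Finset PlaneForest := (finite_size_eq n).toFinset

end PlaneForest

open PlaneForest

/-- The noncommutative Connes-Kreimer coalgebra: the free `K`-module on plane forests. (Only
its coalgebra structure matters for the product of its dual.) -/
def HNCK (K : Type*) [CommRing K] : Type _ := PlaneForest →₀ K

namespace HNCK
variable (K : Type*) [CommRing K]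

instance : AddCommGroup (HNCK K) := inferInstanceAs (AddCommGroup (PlaneForest →₀ K))
instance : Module K (HNCK K) := inferInstanceAs (Module K (PlaneForest →₀ K))

/-- The natural basis `Y_F`. -/
def Y : Module.Basis PlaneForest K (HNCK K) :=
  Module.Basis.ofRepr (LinearEquiv.refl K (PlaneForest →₀ K))

/-- `Δ Y_F = ∑ Y_{F₍₁₎} ⊗ Y_{F₍₂₎}` over the nondecreasing labellings of `F` by two letters
(here `0 < 1` instead of `1 < 2`), with counit `ε(Y_F) = 1` if `F` is empty and `0` otherwise. -/
instance : CoalgebraStruct K (HNCK K) where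
  comul := (Y K).constr K fun F => ∑ u ∈ F.cuts, Y K (F.part u 0) ⊗ₜ[K] Y K (F.part u 1)
  counit := (Y K).constr K fun F => match F with
    | .empty => 1
    | .graft _ _ => 0

theorem comul_Y (F : PlaneForest) :
    Coalgebra.comul (R := K) (Y K F) = ∑ u ∈ F.cuts, Y K (F.part u 0) ⊗ₜ[K] Y K (F.part u 1) :=
  (Y K).constr_basis K _ F

theorem comul_Y' (F : PlaneForest) :
    Coalgebra.comul (R := K) (Y K F) = F.cutSum fun P Q => Y K P ⊗ₜ[K] Y K Q := by
  rw [comul_Y, sum_cuts F fun P Q => Y K P ⊗ₜ[K] Y K Q]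

theorem counit_empty : Coalgebra.counit (R := K) (Y K .empty) = 1 :=
  (Y K).constr_basis K _ _

theorem counit_ne (F : PlaneForest) (h : F ≠ .empty) :
    Coalgebra.counit (R := K) (Y K F) = 0 := by
  cases F with
  | empty => exact absurd rfl h
  | graft C R => exact (Y K).constr_basis K _ _

theorem map_cutSum {M N : Type*} [AddCommGroup M] [Module K M] [AddCommGroup N] [Module K N]
    (φ : M →ₗ[K] N) (F : PlaneForest) (f : PlaneForest → PlaneForest → M) :
    φ (F.cutSum f) = F.cutSum fun P Q => φ (f P Q) :=
  cutSum_map φ.toAddMonoidHom F f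

instance : Coalgebra K (HNCK K) where
  coassoc := by
    refine (Y K).ext fun F => ?_
    simp only [LinearMap.comp_apply, LinearEquiv.coe_coe, comul_Y', map_cutSum,
      LinearMap.rTensor_tmul, LinearMap.lTensor_tmul]
    have h1 : ∀ P Q : PlaneForest,
        (TensorProduct.assoc K (HNCK K) (HNCK K) (HNCK K))
          ((P.cutSum fun A B => Y K A ⊗ₜ[K] Y K B) ⊗ₜ[K] Y K Q) =
        P.cutSum fun A B => Y K A ⊗ₜ[K] (Y K B ⊗ₜ[K] Y K Q) := fun P Q =>
      map_cutSum K ((TensorProduct.assoc K (HNCK K) (HNCK K) (HNCK K)).toLinearMap ∘ₗ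
        (TensorProduct.mk K (HNCK K ⊗[K] HNCK K) (HNCK K)).flip (Y K Q)) P _
    have h2 : ∀ P Q : PlaneForest,
        Y K P ⊗ₜ[K] (Q.cutSum fun A B => Y K A ⊗ₜ[K] Y K B) =
        Q.cutSum fun A B => Y K P ⊗ₜ[K] (Y K A ⊗ₜ[K] Y K B) := fun P Q =>
      map_cutSum K (TensorProduct.mk K (HNCK K) (HNCK K ⊗[K] HNCK K) (Y K P)) Q _
    simp only [h1, h2]
    exact cutSum_coassoc F fun A B D => Y K A ⊗ₜ[K] (Y K B ⊗ₜ[K] Y K D)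
  rTensor_counit_comp_comul := by
    refine (Y K).ext fun F => ?_
    simp only [LinearMap.comp_apply, comul_Y', map_cutSum, LinearMap.rTensor_tmul]
    rw [cutSum_left]
    · simp [counit_empty]
    · intro P Q h; rw [counit_ne K P h, TensorProduct.zero_tmul]
  lTensor_counit_comp_comul := by
    refine (Y K).ext fun F => ?_
    simp only [LinearMap.comp_apply, comul_Y', map_cutSum, LinearMap.lTensor_tmul]
    rw [cutSum_right]
    · simp [counit_empty]
    · intro P Q h; rw [counit_ne K Q h, TensorProduct.tmul_zero]

theorem conv_mul_Y (f g : WithConv (HNCK K →ₗ[K] K)) (F : PlaneForest) :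
    (f * g) (Y K F) = F.cutSum fun P Q => f (Y K P) * g (Y K Q) := by
  rw [LinearMap.convMul_apply, comul_Y', map_cutSum, map_cutSum]
  simp

end HNCK

/-- The graded dual `H_NCK^*`: the linear forms on `H_NCK` that vanish on all but finitely many
`Y_F`, with the product dual to the coproduct, `⟨Y_F, a b⟩ = ⟨Δ Y_F, a ⊗ b⟩`, inside the
convolution algebra of linear forms. -/
def HNCKDual (K : Type*) [CommRing K] : Subalgebra K (WithConv (HNCK K →ₗ[K] K)) where
  carrier := {f | {F : PlaneForest | f (HNCK.Y K F) ≠ 0}.Finite}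
  mul_mem' := by
    intro f g hf hg
    obtain ⟨N, hN⟩ := (hf.image size).bddAbove
    obtain ⟨M, hM⟩ := (hg.image size).bddAbove
    refine (finite_size_le (N + M)).subset fun F hF => ?_
    by_contra hlt
    simp only [Set.mem_ofPred_eq, not_le] at hlt
    refine hF ?_
    rw [HNCK.conv_mul_Y, ← cutSum_zero F]
    refine cutSum_congr_size F _ _ fun P Q hPQ => ?_
    by_cases hP : f (HNCK.Y K P) = 0
    · rw [hP, zero_mul]
    by_cases hQ : g (HNCK.Y K Q) = 0
    · rw [hQ, mul_zero]
    have h1 : P.size ≤ N := hN ⟨P, hP, rfl⟩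
    have h2 : Q.size ≤ M := hM ⟨Q, hQ, rfl⟩
    omega
  add_mem' := by
    intro f g hf hg
    refine (Set.Finite.union hf hg).subset fun F hF => ?_
    by_contra h
    simp only [Set.mem_union, Set.mem_ofPred_eq, not_or, not_not] at h
    refine hF ?_
    change f.ofConv (HNCK.Y K F) + g.ofConv (HNCK.Y K F) = 0
    rw [h.1, h.2, add_zero]
  algebraMap_mem' := by
    intro r
    refine (Set.finite_singleton PlaneForest.empty).subset fun F hF => ?_
    by_contra h
    refine hF ?_
    rw [LinearMap.convAlgebraMap_apply, HNCK.counit_ne K F h, map_zero, smul_zero]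

namespace HNCKDual
variable (K : Type*) [CommRing K]

/-- Coordinates: `a ↦ (F ↦ ⟨Y_F, a⟩)`. -/
def coords : HNCKDual K ≃ₗ[K] (PlaneForest →₀ K) where
  toFun a := Finsupp.ofSupportFinite (fun F => a.1 (HNCK.Y K F)) a.2
  map_add' _ _ := Finsupp.ext fun _ => rfl
  map_smul' _ _ := Finsupp.ext fun _ => rfl
  invFun c := ⟨WithConv.toConv ((HNCK.Y K).constr K fun F => c F), by
    refine c.support.finite_toSet.subset fun F hF => ?_
    rw [Finset.mem_coe, Finsupp.mem_support_iff]
    intro h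
    refine hF ?_
    change (HNCK.Y K).constr K (fun F => c F) (HNCK.Y K F) = 0
    rw [Module.Basis.constr_basis, h]⟩
  left_inv a := Subtype.ext <| WithConv.ext <| (HNCK.Y K).ext fun F => by
    exact (HNCK.Y K).constr_basis K _ F
  right_inv c := Finsupp.ext fun F => by
    exact (HNCK.Y K).constr_basis K _ F

/-- The basis `X_F` of `H_NCK^*` dual to `Y_F`. -/
def X : Module.Basis PlaneForest K (HNCKDual K) := Module.Basis.ofRepr (coords K)

/-- The coefficient of `X_F` in `a` is `⟨Y_F, a⟩`; in particular `X_F` is the dual basis. -/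
theorem X_repr (a : HNCKDual K) (F : PlaneForest) : (X K).repr a F = a.1 (HNCK.Y K F) := rfl

open Classical in
theorem X_Y (F G : PlaneForest) :
    (X K F).1 (HNCK.Y K G) = if F = G then 1 else 0 := by
  rw [← X_repr, Module.Basis.repr_self, Finsupp.single_apply]

end HNCKDual

/-- Noncommutative symmetric functions: the free associative algebra on `S_1, S_2, …`. -/
abbrev NSym (K : Type*) [CommRing K] : Type _ := FreeAlgebra K ℕ+

namespace NSym
variable (K : Type*) [CommRing K]

/-- The complete functions `S_n`, with `S_0 = 1`. -/
def S (n : ℕ) : NSym K := if h : 0 < n then FreeAlgebra.ι K ⟨n, h⟩ else 1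

/-- `S^I = S_{i_1} S_{i_2} ⋯ S_{i_r}`. -/
def SProd {n : ℕ} (I : Composition n) : NSym K := (I.blocks.map (S K)).prod

open Classical in
/-- The ribbon Schur function `R_I = ∑_J (-1)^{ℓ(I)-ℓ(J)} S^J`, over the compositions `J` that are
coarser than (or equal to) `I`. -/
def ribbon {n : ℕ} (I : Composition n) : NSym K :=
  ∑ J ∈ Finset.univ.filter (fun J : Composition n => J.boundaries ⊆ I.boundaries),
    (-1) ^ (I.length - J.length) * SProd K J

/-- The algebra morphism `Sym → H_NCK^*` with `S_n ↦ ∑_{|F| = n} X_F`. -/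
def toHNCKDual : NSym K →ₐ[K] HNCKDual K :=
  FreeAlgebra.lift K fun n : ℕ+ => ∑ F ∈ ofSize n, HNCKDual.X K F

end NSym

open Classical in
/-- The ribbon shape (descent composition) of a permutation `σ`, read as the word
`σ 0, …, σ (n-1)`: a new part starts after each descent. -/
def ribbonShape {n : ℕ} (σ : Equiv.Perm (Fin n)) : Composition n :=
  CompositionAsSet.toComposition
    { boundaries := Finset.univ.filter fun k : Fin (n + 1) =>
        k = 0 ∨ k = Fin.last n ∨
          ∃ (i : ℕ) (h : i + 1 < n), k.val = i + 1 ∧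
            σ ⟨i + 1, h⟩ < σ ⟨i, Nat.lt_of_succ_lt h⟩
      zero_mem := by simp
      getLast_mem := by simp }

end

/-! Coefficients. Iterating the coproduct, the coefficient of `X_F` in the image of `S^J` counts the
nondecreasing labellings of `F` with `j_k` labels `k` (`toHNCKDual_SProd`). Standardize such a
labelling: list the nodes by label, ties broken by postorder name. Postorder is itself a linear
extension, so the list is a linear extension, and its descents occur only where the label changes.
This is a bijection onto the linear extensions whose ribbon shape is coarser than or equal to `J`
(`card_labellings_eq`). The alternating sum defining `R_I` then isolates the shape exactly `I`, by
inclusion-exclusion in a Boolean lattice (`sum_neg_one_pow_boundaries`).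

Injectivity. The images of the `S_n` have many terms, so one passes to the elementary functions
`Λ_n`. They generate `Sym` (`elementaryHom_surjective`), and `Λ_n` maps to the single basis element
`X_{dots n}`, because the signed sum over the sets of leaves of a nonempty forest vanishes
(`cutSum_signDots`). A product of elements `X_{dots j}` counts the ways to peel a forest into
antichains of prescribed sizes. On caterpillars these counts are unitriangular for a suitable order
on words, so `dotsHom` is injective. The given morphism composed with a surjection is therefore
injective, which makes the morphism itself injective. The argument works over every commutative
ring, since the diagonal entries are `1`. -/

open PlaneForest

namespace PlaneForest

/-! ### Counting nondecreasing labellings recursively -/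

section labelSum
variable {M : Type*} [AddCommMonoid M]

/-- The sum of `f (content u)` over the nondecreasing labellings `u` of `F` by `0, …, r - 1`,
where the content is the multiset of the labels, computed recursively. -/
def labelSum : PlaneForest → ℕ → (Multiset ℕ → M) → M
  | empty, _, f => f 0
  | graft C R, r, f => ∑ k ∈ Finset.range r,
      C.labelSum (k + 1) fun a => R.labelSum r fun b => f (a + {k} + b)

theorem cutSum_finset_sum {ι : Type*} (s : Finset ι) (F : PlaneForest)
    (f : ι → PlaneForest → PlaneForest → M) :
    F.cutSum (fun P Q => ∑ k ∈ s, f k P Q) = ∑ k ∈ s, F.cutSum (f k) := by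
  classical
  induction s using Finset.induction_on with
  | empty => simp only [Finset.sum_empty, cutSum_zero]
  | insert a s ha ih => simp only [Finset.sum_insert ha, cutSum_add, ih]

theorem cutSum_labelSum_comm (F G : PlaneForest) (r : ℕ)
    (f : PlaneForest → PlaneForest → Multiset ℕ → M) :
    G.cutSum (fun P Q => F.labelSum r fun a => f P Q a) =
      F.labelSum r fun a => G.cutSum fun P Q => f P Q a := by
  induction F generalizing r f with
  | empty => rfl
  | graft C R ihC ihR =>
    simp only [labelSum, cutSum_finset_sum]
    refine Finset.sum_congr rfl fun k _ => ?_
    rw [ihC]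
    congr 1
    funext a
    rw [ihR]

theorem labelSum_append (F G : PlaneForest) (r : ℕ) (f : Multiset ℕ → M) :
    (F.append G).labelSum r f = F.labelSum r fun a => G.labelSum r fun b => f (a + b) := by
  induction F generalizing f with
  | empty => simp [append, labelSum]
  | graft C R _ ih => simp only [append, labelSum, ih, add_assoc]

/-- Labelling the upper part of an admissible cut by `r` and its lower part by `0, …, r - 1`
gives every nondecreasing labelling by `0, …, r` once. -/
theorem cutSum_labelSum (F : PlaneForest) (r : ℕ) (f : Multiset ℕ → M) :
    F.cutSum (fun P Q => P.labelSum r fun a => f (a + Multiset.replicate Q.size r)) =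
      F.labelSum (r + 1) f := by
  induction F generalizing f with
  | empty => simp [cutSum, labelSum, size]
  | graft C R ihC ihR =>
    -- Split by the label of the first root. If it is less than `r`, the root lies in the lower part
    -- and so does all of `C`; the label `r` means that the root lies in the upper part. These are
    -- the two summands of `cutSum`.
    simp only [cutSum, labelSum, labelSum_append, Finset.sum_range_succ]
    congr 1
    · rw [cutSum_finset_sum]
      refine Finset.sum_congr rfl fun k _ => ?_
      rw [cutSum_labelSum_comm]
      congr 1
      funext a
      rw [← ihR]
      simp only [add_assoc]
    · rw [← ihC]
      congr 1
      funext P₁ Q₁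
      rw [cutSum_labelSum_comm]
      congr 1
      funext a
      rw [← ihR]
      congr 1
      funext P₂ Q₂
      congr 1
      funext b
      congr 1
      simp only [size, Multiset.replicate_add, Multiset.replicate_one]
      abel

/-- Only contents with entries below `r` occur. This is what later separates the copies of a new
largest label from the rest. -/
theorem labelSum_congr (F : PlaneForest) (r : ℕ) (f g : Multiset ℕ → M)
    (h : ∀ a : Multiset ℕ, (∀ x ∈ a, x < r) → f a = g a) :
    F.labelSum r f = F.labelSum r g := by
  induction F generalizing r f g with
  | empty => exact h 0 (by simp)
  | graft C R ihC ihR =>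
    simp only [labelSum]
    refine Finset.sum_congr rfl fun k hk => ?_
    have hk := Finset.mem_range.mp hk
    refine ihC _ _ _ fun a ha => ihR _ _ _ fun b hb => h _ fun x hx => ?_
    simp only [Multiset.mem_add, Multiset.mem_singleton] at hx
    rcases hx with (hx | hx) | hx
    · have := ha x hx; omega
    · omega
    · exact hb x hx

open Classical in
/-- The nondecreasing labellings of `F` by `0, …, r - 1`. -/
noncomputable def labellings (F : PlaneForest) (r : ℕ) : Finset (Fin F.size → ℕ) :=
  (Fintype.piFinset fun _ => Finset.range r).filter fun u => F.IsNondecreasing u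

theorem mem_labellings {F : PlaneForest} {r : ℕ} {u : Fin F.size → ℕ} :
    u ∈ F.labellings r ↔ (∀ i, u i < r) ∧ F.IsNondecreasing u := by
  simp [labellings]

/-- The multiset of the values of a labelling. -/
def content {n : ℕ} (u : Fin n → ℕ) : Multiset ℕ := ∑ i, {u i}

theorem content_glue (C R : PlaneForest) (a : Fin C.size → ℕ) (x : Fin 1 → ℕ)
    (b : Fin R.size → ℕ) :
    content (glue C R ((a, x), b)) = content a + {x 0} + content b := by
  change ∑ i : Fin (C.size + 1 + R.size),
    ({(Fin.append (Fin.append a x) b) i} : Multiset ℕ) = _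
  rw [Fin.sum_univ_add, Fin.sum_univ_add]
  simp [content]

theorem forall_glue {C R : PlaneForest} {p : Fin (graft C R).size → Prop} :
    (∀ i, p i) ↔ (∀ i, p (inSub C R i)) ∧ p (firstRoot C R) ∧ ∀ i, p (inRest C R i) := by
  refine ⟨fun h => ⟨fun i => h _, h _, fun i => h _⟩, fun ⟨h1, h2, h3⟩ i => ?_⟩
  refine Fin.addCases (m := C.size + 1) (n := R.size) (motive := p) (fun j => ?_) h3 i
  refine Fin.addCases (m := C.size) (n := 1)
    (motive := fun j => p (Fin.castAdd R.size j)) h1 (fun j => ?_) j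
  rw [Subsingleton.elim j 0]
  exact h2

/-- A labelling of `graft C R` is a root label `k` together with labellings of `C` and `R`; being
nondecreasing at the root means that the labels of `C` are less than `k + 1`. -/
theorem sum_labellings (F : PlaneForest) (r : ℕ) (f : Multiset ℕ → M) :
    ∑ u ∈ F.labellings r, f (content u) = F.labelSum r f := by
  induction F generalizing r f with
  | empty =>
    have h : empty.labellings r = {(fun _ => 0 : Fin empty.size → ℕ)} := by
      ext u
      rw [mem_labellings, Finset.mem_singleton]
      exact ⟨fun _ => funext fun i => Fin.elim0 i,
        fun _ => ⟨fun i => Fin.elim0 i, fun i => Fin.elim0 i⟩⟩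
    rw [h, Finset.sum_singleton]
    rfl
  | graft C R ihC ihR =>
    simp only [labelSum, ← ihR, ← ihC]
    simp_rw [← Finset.sum_product', Finset.sum_sigma']
    refine Finset.sum_bij'
      (i := fun u _ => ⟨u (firstRoot C R), (fun i => u (inSub C R i), fun i => u (inRest C R i))⟩)
      (j := fun t _ => glue C R ((t.2.1, fun _ => t.1), t.2.2)) ?_ ?_ ?_ ?_ ?_
    · intro u hu
      rw [mem_labellings, isNondecreasing_graft, forall_glue] at hu
      simp only [Finset.mem_sigma, Finset.mem_product, Finset.mem_range, mem_labellings]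
      exact ⟨hu.1.2.1, ⟨fun i => Nat.lt_succ_of_le (hu.2.2.2 i), hu.2.1⟩, hu.1.2.2, hu.2.2.1⟩
    · rintro ⟨k, a, b⟩ ht
      simp only [Finset.mem_sigma, Finset.mem_product, Finset.mem_range, mem_labellings] at ht
      obtain ⟨hk, ⟨h1, h2⟩, h3, h4⟩ := ht
      rw [mem_labellings, isNondecreasing_graft, forall_glue]
      simp only [glue_inSub, glue_firstRoot, glue_inRest]
      exact ⟨⟨fun i => by have := h1 i; omega, hk, h3⟩, h2, h4,
        fun i => Nat.le_of_lt_succ (h1 i)⟩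
    · intro u _
      funext i
      revert i
      rw [forall_glue]
      simp only [glue_inSub, glue_firstRoot, glue_inRest, implies_true, and_self]
    · rintro ⟨k, a, b⟩ _
      simp only [glue_inSub, glue_firstRoot, glue_inRest]
    · intro u _
      rw [← content_glue C R _ (fun _ => u (firstRoot C R))]
      congr 2
      funext i
      revert i
      rw [forall_glue]
      simp only [glue_inSub, glue_firstRoot, glue_inRest, implies_true, and_self]

end labelSum

theorem mem_ofSize {n : ℕ} {F : PlaneForest} : F ∈ ofSize n ↔ F.size = n := by
  simp [ofSize]

theorem size_eq_zero {F : PlaneForest} : F.size = 0 ↔ F = empty := by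
  cases F with
  | empty => simp [size]
  | graft C R => simp [size]

end PlaneForest

/-! ### Coefficients of the images of products of complete functions -/

namespace HNCKDual
variable (K : Type*) [CommRing K]

theorem mul_Y (a b : HNCKDual K) (F : PlaneForest) :
    (a * b).1 (HNCK.Y K F) =
      F.cutSum fun P Q => a.1 (HNCK.Y K P) * b.1 (HNCK.Y K Q) :=
  HNCK.conv_mul_Y K a.1 b.1 F

open Classical in
theorem one_Y (F : PlaneForest) :
    (1 : HNCKDual K).1 (HNCK.Y K F) = if F = empty then 1 else 0 := by
  change (1 : WithConv (HNCK K →ₗ[K] K)) (HNCK.Y K F) = _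
  rw [LinearMap.convOne_apply]
  split_ifs with h
  · rw [h, HNCK.counit_empty, map_one]
  · rw [HNCK.counit_ne K F h, map_zero]

theorem smul_Y (c : K) (a : HNCKDual K) (F : PlaneForest) :
    (c • a).1 (HNCK.Y K F) = c * a.1 (HNCK.Y K F) := rfl

theorem sum_Y {ι : Type*} (s : Finset ι) (a : ι → HNCKDual K) (F : PlaneForest) :
    (∑ i ∈ s, a i).1 (HNCK.Y K F) = ∑ i ∈ s, (a i).1 (HNCK.Y K F) := by
  simp only [← X_repr, map_sum, Finsupp.finsetSum_apply]

theorem ext_Y {a b : HNCKDual K}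
    (h : ∀ F, a.1 (HNCK.Y K F) = b.1 (HNCK.Y K F)) : a = b :=
  (X K).repr.injective (Finsupp.ext h)

end HNCKDual

namespace NSym
variable (K : Type*) [CommRing K]

theorem S_pnat (n : ℕ+) : S K n = FreeAlgebra.ι K n := dif_pos n.2

theorem S_zero : S K 0 = 1 := rfl

theorem toHNCKDual_S (n : ℕ) (F : PlaneForest) :
    (toHNCKDual K (S K n)).1 (HNCK.Y K F) = if F.size = n then 1 else 0 := by
  classical
  rcases Nat.eq_zero_or_pos n with rfl | h
  · rw [S_zero, map_one, HNCKDual.one_Y]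
    exact if_congr size_eq_zero.symm rfl rfl
  · lift n to ℕ+ using h
    rw [S_pnat, toHNCKDual, FreeAlgebra.lift_ι_apply, HNCKDual.sum_Y]
    simp [HNCKDual.X_Y, mem_ofSize]

/-- The multiset with `l_k` copies of `k`. -/
def blockContent (l : List ℕ) : Multiset ℕ :=
  ∑ k : Fin l.length, Multiset.replicate (l.get k) k.val

theorem blockContent_concat (l : List ℕ) (j : ℕ) :
    blockContent (l ++ [j]) = blockContent l + Multiset.replicate j l.length := by
  have h : (l ++ [j]).length = l.length + 1 := by simp
  unfold blockContent
  rw [← (finCongr h.symm).sum_comp, Fin.sum_univ_castSucc]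
  simp

theorem lt_of_mem_blockContent {l : List ℕ} {x : ℕ} (h : x ∈ blockContent l) : x < l.length := by
  simp only [blockContent, Multiset.mem_sum] at h
  obtain ⟨k, -, hk⟩ := h
  rw [Multiset.eq_of_mem_replicate hk]
  exact k.2

theorem add_replicate_inj {r m j : ℕ} {a b : Multiset ℕ} (ha : ∀ x ∈ a, x < r)
    (hb : ∀ x ∈ b, x < r) :
    a + Multiset.replicate m r = b + Multiset.replicate j r ↔ a = b ∧ m = j := by
  refine ⟨fun h => ?_, fun h => by rw [h.1, h.2]⟩
  have ha' : a.count r = 0 := Multiset.count_eq_zero.mpr fun h => lt_irrefl _ (ha r h)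
  have hb' : b.count r = 0 := Multiset.count_eq_zero.mpr fun h => lt_irrefl _ (hb r h)
  have hm : m = j := by simpa [ha', hb'] using congrArg (Multiset.count r) h
  subst hm
  exact ⟨add_right_cancel h, rfl⟩

-- The last factor is paired with the upper part of the cut, which must carry the largest label.
-- Hence the induction removes factors from the right.
open Classical in
theorem toHNCKDual_prod_S (l : List ℕ) (F : PlaneForest) :
    (toHNCKDual K (l.map (S K)).prod).1 (HNCK.Y K F) =
      F.labelSum l.length fun a => if a = blockContent l then 1 else 0 := by
  induction l using List.reverseRecOn generalizing F with
  | nil =>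
    rw [List.map_nil, List.prod_nil, map_one, HNCKDual.one_Y]
    cases F with
    | empty => simp [labelSum, blockContent]
    | graft C R => simp [labelSum]
  | append_singleton l j ih =>
    rw [List.map_append, List.prod_append, map_mul, HNCKDual.mul_Y, List.length_append,
      List.length_singleton, ← cutSum_labelSum]
    congr 1
    funext P Q
    rw [ih, List.map_singleton, List.prod_singleton, toHNCKDual_S]
    have h : ∀ a : Multiset ℕ, (∀ x ∈ a, x < l.length) →
        (if a + Multiset.replicate Q.size l.length = blockContent (l ++ [j]) then (1 : K) else 0) =
          if Q.size = j then (if a = blockContent l then 1 else 0) else 0 := by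
      intro a ha
      rw [blockContent_concat, ← ite_and]
      refine if_congr ?_ rfl rfl
      rw [add_replicate_inj ha fun x hx => lt_of_mem_blockContent hx, and_comm]
    rw [labelSum_congr P _ _ _ h]
    split_ifs with hj
    · rw [mul_one]
    · rw [mul_zero, ← sum_labellings]
      simp

open Classical in
theorem toHNCKDual_SProd {n : ℕ} (J : Composition n) (F : PlaneForest) :
    (toHNCKDual K (SProd K J)).1 (HNCK.Y K F) =
      (((F.labellings J.length).filter fun u => content u = blockContent J.blocks).card : K) := by
  rw [SProd, toHNCKDual_prod_S, ← sum_labellings, Finset.sum_boole, Composition.length]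

end NSym

/-! ### Cuts of single-node forests and caterpillars -/

namespace PlaneForest

/-- The forest of `n` single nodes. -/
def dots : ℕ → PlaneForest
  | 0 => empty
  | n + 1 => graft empty (dots n)

theorem size_dots (n : ℕ) : (dots n).size = n := by
  induction n with
  | zero => rfl
  | succ n ih => simp [dots, size, ih]; omega

theorem dots_append_eq_dots {b j : ℕ} {Q : PlaneForest} :
    (dots b).append (graft Q empty) = dots j ↔ Q = empty ∧ b + 1 = j := by
  induction b generalizing j with
  | zero =>
    cases j with
    | zero => simp [dots, append]
    | succ j =>
      cases j with
      | zero => simp [dots, append]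
      | succ j => simp [dots, append]
  | succ b ih =>
    cases j with
    | zero => simp [dots, append]
    | succ j => simp [dots, append, ih]

section cutSum
variable {M : Type*} [AddCommMonoid M]

/-- Each of the `c` single nodes goes freely to either part, so every cut restricts to a cut of `G`
with `a` of them below and `b` above. -/
theorem cutSum_dots_append_eq_zero (c : ℕ) (G : PlaneForest)
    (f : PlaneForest → PlaneForest → M)
    (h : ∀ a b, a + b = c →
      G.cutSum (fun P Q => f ((dots a).append P) ((dots b).append Q)) = 0) :
    ((dots c).append G).cutSum f = 0 := by
  induction c generalizing f with
  | zero => exact h 0 0 rfl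
  | succ c ih =>
    simp only [dots, append, cutSum]
    rw [ih, ih, add_zero]
    · intro a b hab
      exact h a (b + 1) (by omega)
    · intro a b hab
      exact h (a + 1) b (by omega)

/-- The hypothesis kills all cuts that leave some single node in the lower part, so only those with
all `c` nodes above survive. -/
theorem cutSum_dots_append (c : ℕ) (G : PlaneForest) (f : PlaneForest → PlaneForest → M)
    (h : ∀ a b, a + 1 + b = c →
      G.cutSum (fun P Q => f ((dots (a + 1)).append P) ((dots b).append Q)) = 0) :
    ((dots c).append G).cutSum f = G.cutSum (fun P Q => f P ((dots c).append Q)) := by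
  induction c generalizing f with
  | zero => rfl
  | succ c ih =>
    simp only [dots, append, cutSum]
    rw [cutSum_dots_append_eq_zero c G, zero_add, ih]
    · intro a b hab
      exact h a (b + 1) (by omega)
    · intro a b hab
      exact h a b (by omega)

/-- A tree whose root is in the lower part lies there entirely. -/
theorem cutSum_singleTree (C : PlaneForest) (f : PlaneForest → PlaneForest → M) :
    (graft C empty).cutSum f = f (graft C empty) empty +
      C.cutSum (fun P Q => f P (graft Q empty)) := by
  simp only [cutSum, append_empty]

end cutSum

theorem dots_append_dots_append (a b : ℕ) (F : PlaneForest) :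
    (dots a).append ((dots b).append F) = (dots (a + b)).append F := by
  induction a with
  | zero => simp [dots, append]
  | succ a ih => rw [Nat.succ_add]; simp only [dots, append, ih]

/-- The caterpillar forest with `m_k` nodes at height `k`, counted from the top. -/
def caterpillar : List ℕ+ → PlaneForest
  | [] => empty
  | m :: I => (dots m.natPred).append (graft (caterpillar I) empty)

/-- The signed indicator function of the forests of single nodes. -/
def signDots (K : Type*) [CommRing K] : PlaneForest → K
  | empty => 1
  | graft empty R => -signDots K R
  | graft (graft _ _) _ => 0

section signDots
variable (K : Type*) [CommRing K]

theorem signDots_append (F G : PlaneForest) :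
    signDots K (F.append G) = signDots K F * signDots K G := by
  induction F with
  | empty => simp [append, signDots]
  | graft C R _ ih => cases C <;> simp [append, signDots, ih]

open Classical in
theorem signDots_eq (F : PlaneForest) :
    signDots K F = if F = dots F.size then (-1) ^ F.size else 0 := by
  induction F with
  | empty => simp [signDots, dots, size]
  | graft C R _ ih =>
    cases C with
    | empty =>
      rw [signDots, ih]
      simp only [size, zero_add, add_comm 1, dots, graft.injEq, true_and]
      split_ifs <;> simp [pow_succ]
    | graft A B =>
      have h : graft (graft A B) R ≠ dots (graft (graft A B) R).size := by
        rw [size, Nat.add_right_comm]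
        simp [dots]
      rw [if_neg h, signDots]

theorem mul_cutSum (c : K) (F : PlaneForest) (f : PlaneForest → PlaneForest → K) :
    F.cutSum (fun P Q => c * f P Q) = c * F.cutSum f :=
  (cutSum_map (AddMonoidHom.mulLeft c) F f).symm

theorem cutSum_mul (c : K) (F : PlaneForest) (f : PlaneForest → PlaneForest → K) :
    F.cutSum (fun P Q => f P Q * c) = F.cutSum f * c :=
  (cutSum_map (AddMonoidHom.mulRight c) F f).symm

/-- The sum of `(-1)^|A|` over the sets `A` of leaves of a nonempty forest vanishes. -/
theorem cutSum_signDots (F : PlaneForest) (h : F ≠ empty) :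
    F.cutSum (fun P _ => signDots K P) = 0 := by
  induction F with
  | empty => exact absurd rfl h
  | graft C R ihC ihR =>
    simp only [cutSum, signDots_append, mul_cutSum, cutSum_mul]
    -- A one-node first tree may lie in either part, with opposite signs. If `C` is nonempty, a root
    -- in the lower part contributes zero, and otherwise the sum over the cuts of `C` splits off and
    -- vanishes by induction.
    cases C with
    | empty =>
      have := mul_cutSum K (-1) R fun P _ => signDots K P
      simp only [neg_one_mul] at this
      simp [signDots, cutSum, this]
    | graft A B => simp [ihC (by simp), signDots, cutSum_zero]

end signDots

end PlaneForest

/-! ### Injectivity through elementary functions -/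

namespace NSym
variable (K : Type*) [CommRing K]

/-- The elementary functions up to sign, `(-1)^n Λ_n`, defined by
`∑_{k ≤ n} (-1)^k Λ_k S_{n-k} = 0` for `n ≥ 1`. -/
noncomputable def signedElementary (n : ℕ) : NSym K :=
  if n = 0 then 1 else -∑ k : Fin n, signedElementary k * S K (n - k)
termination_by n

theorem signedElementary_zero : signedElementary K 0 = 1 := by
  rw [signedElementary, if_pos rfl]

theorem signedElementary_of_pos {n : ℕ} (h : n ≠ 0) :
    signedElementary K n = -∑ k ∈ Finset.range n, signedElementary K k * S K (n - k) := by
  rw [signedElementary, if_neg h, Finset.sum_range]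

/-- This is the recursion of `signedElementary` with its expected images inserted. On a forest with
`n` nodes, the sum over `k` merges into the cut sum of `signDots`. -/
theorem sum_X_dots_mul_S {n : ℕ} (h : n ≠ 0) :
    ∑ k ∈ Finset.range (n + 1),
      ((-1 : K) ^ k • HNCKDual.X K (dots k) : HNCKDual K) * toHNCKDual K (S K (n - k)) = 0 := by
  classical
  refine HNCKDual.ext_Y K fun F => ?_
  have hs : ∀ (k : ℕ) (P : PlaneForest),
      ((-1 : K) ^ k • HNCKDual.X K (dots k) : HNCKDual K).1 (HNCK.Y K P) =
        if dots k = P then (-1 : K) ^ k else 0 := by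
    intro k P
    rw [HNCKDual.smul_Y, HNCKDual.X_Y]
    simp
  rw [HNCKDual.sum_Y]
  simp only [HNCKDual.mul_Y, hs, toHNCKDual_S, ← cutSum_finset_sum]
  change _ = (0 : K)
  by_cases hF : F.size = n
  · refine Eq.trans ?_ (cutSum_signDots K F (by rintro rfl; exact h hF.symm))
    refine cutSum_congr_size F _ _ fun P Q hPQ => ?_
    rw [signDots_eq, Finset.sum_eq_single P.size]
    · have : Q.size = n - P.size := by omega
      simp [this, eq_comm]
    · intro k _ hk
      rw [if_neg, zero_mul]
      rintro rfl
      exact hk (size_dots k).symm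
    · intro hP
      exact absurd (Finset.mem_range.mpr (by omega)) hP
  · refine Eq.trans ?_ (cutSum_zero F)
    refine cutSum_congr_size F _ _ fun P Q hPQ => Finset.sum_eq_zero fun k hk => ?_
    have hk := Finset.mem_range.mp hk
    by_cases h1 : dots k = P
    · rw [if_neg (c := Q.size = n - k), mul_zero]
      rw [← h1, size_dots] at hPQ
      omega
    · rw [if_neg h1, zero_mul]

theorem toHNCKDual_signedElementary (n : ℕ) :
    toHNCKDual K (signedElementary K n) = (-1 : K) ^ n • HNCKDual.X K (dots n) := by
  induction n using Nat.strong_induction_on with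
  | _ n ih =>
    rcases eq_or_ne n 0 with rfl | hn
    · rw [signedElementary_zero, map_one]
      refine HNCKDual.ext_Y K fun F => ?_
      rw [HNCKDual.one_Y, pow_zero, one_smul, HNCKDual.X_Y, dots]
      by_cases h : F = empty
      · rw [if_pos h, if_pos h.symm]
      · rw [if_neg h, if_neg (Ne.symm h)]
    · have h := sum_X_dots_mul_S K hn
      rw [Finset.sum_range_succ, Nat.sub_self, S_zero, map_one, mul_one] at h
      rw [signedElementary_of_pos K hn, map_neg, map_sum, eq_comm, ← add_eq_zero_iff_eq_neg',
        ← h]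
      congr 1
      refine Finset.sum_congr rfl fun k hk => ?_
      rw [map_mul, ih k (Finset.mem_range.mp hk)]

/-- The endomorphism of `Sym` with `S_n ↦ Λ_n`. -/
noncomputable def elementaryHom : NSym K →ₐ[K] NSym K :=
  FreeAlgebra.lift K fun n : ℕ+ => (-1 : K) ^ (n : ℕ) • signedElementary K n

theorem elementaryHom_surjective : Function.Surjective (elementaryHom K) := by
  have hE : ∀ n, signedElementary K n ∈ (elementaryHom K).range := by
    intro n
    rcases Nat.eq_zero_or_pos n with rfl | hn
    · rw [signedElementary_zero]; exact one_mem _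
    · lift n to ℕ+ using hn
      have h : signedElementary K n =
          (-1 : K) ^ (n : ℕ) • elementaryHom K (FreeAlgebra.ι K n) := by
        rw [elementaryHom, FreeAlgebra.lift_ι_apply, smul_smul, ← mul_pow]
        simp
      rw [h]
      exact Subalgebra.smul_mem _ (AlgHom.mem_range_self _ _) _
  have hS : ∀ n, S K n ∈ (elementaryHom K).range := by
    intro n
    induction n using Nat.strong_induction_on with
    | _ n ih =>
      rcases eq_or_ne n 0 with rfl | hn
      · rw [S_zero]; exact one_mem _
      · obtain ⟨m, rfl⟩ := Nat.exists_eq_succ_of_ne_zero hn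
        -- The term `k = 0` of the recursion is `S_n` itself, so the recursion can be solved for
        -- `S_n` in terms of elementary functions and smaller `S_k`.
        have h := signedElementary_of_pos K hn
        rw [Finset.sum_range_succ', signedElementary_zero, one_mul, neg_add, Nat.sub_zero,
          ← sub_eq_iff_eq_add', eq_comm, neg_eq_iff_eq_neg] at h
        rw [h]
        refine neg_mem (sub_mem (hE _) (neg_mem (sum_mem fun k _ => mul_mem (hE _) (ih _ ?_))))
        omega
  rw [← AlgHom.range_eq_top, eq_top_iff]
  rintro x -
  induction x using FreeAlgebra.induction with
  | grade0 r => exact Subalgebra.algebraMap_mem _ r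
  | grade1 n =>
    rw [← S_pnat]
    exact hS n
  | mul a b ha hb => exact mul_mem ha hb
  | add a b ha hb => exact add_mem ha hb

/-- The algebra morphism `Sym → H_NCK^*` that maps the `n`-th generator to the dual basis
element of the forest of `n` single nodes. -/
noncomputable def dotsHom : NSym K →ₐ[K] HNCKDual K :=
  FreeAlgebra.lift K fun n : ℕ+ => HNCKDual.X K (dots n)

theorem toHNCKDual_comp_elementaryHom :
    (toHNCKDual K).comp (elementaryHom K) = dotsHom K := by
  refine FreeAlgebra.hom_ext (funext fun n => ?_)
  simp only [Function.comp_apply, AlgHom.comp_apply, elementaryHom, dotsHom,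
    FreeAlgebra.lift_ι_apply]
  rw [map_smul, toHNCKDual_signedElementary, smul_smul, ← mul_pow]
  simp

/-- The coefficient on `F` of the product of the `X_{dots j}`, for `j` in the reverse of `J`. -/
noncomputable def dotsCoeff (J : List ℕ+) (F : PlaneForest) : K :=
  ((J.reverse.map fun j : ℕ+ => HNCKDual.X K (dots j)).prod).1 (HNCK.Y K F)

open Classical in
theorem dotsCoeff_nil (F : PlaneForest) : dotsCoeff K [] F = if F = empty then 1 else 0 :=
  HNCKDual.one_Y K F

open Classical in
theorem dotsCoeff_cons (j : ℕ+) (J : List ℕ+) (F : PlaneForest) :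
    dotsCoeff K (j :: J) F =
      F.cutSum fun P Q => dotsCoeff K J P * if Q = dots j then 1 else 0 := by
  rw [dotsCoeff, List.reverse_cons, List.map_append, List.prod_append, HNCKDual.mul_Y]
  simp [HNCKDual.X_Y, dotsCoeff, eq_comm]

/-- Each letter of `J` peels off an antichain, while the caterpillar contains a chain of `I.length`
nodes. The extra `c` single nodes make the induction work, since a cut may leave some of them
behind. -/
theorem dotsCoeff_eq_zero_of_length_lt (J I : List ℕ+) (h : J.length < I.length) (c : ℕ) :
    dotsCoeff K J ((dots c).append (caterpillar I)) = 0 := by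
  classical
  induction J generalizing I c with
  | nil =>
    cases I with
    | nil => simp at h
    | cons m I =>
      rw [dotsCoeff_nil, if_neg]
      intro h0
      have := congrArg size h0
      simp [caterpillar, size_append, size] at this
  | cons j J ih =>
    cases I with
    | nil => simp at h
    | cons m I =>
      simp only [List.length_cons, Nat.add_lt_add_iff_right] at h
      rw [dotsCoeff_cons, caterpillar, dots_append_dots_append]
      refine cutSum_dots_append_eq_zero _ _ _ fun a b hab => ?_
      rw [cutSum_singleTree]
      -- If the root of the last tree stays below, the remainder is again a caterpillar with
      -- singles, the head `1` accounting for that root alone. If it goes above, the upper part can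
      -- be `dots j` only when nothing under the root goes with it, so `caterpillar I` remains.
      have h1 := ih (1 :: I) (by simp; omega) a
      have h0 : dots (1 : ℕ+).natPred = empty := rfl
      rw [caterpillar, h0, append] at h1
      rw [h1, zero_mul, zero_add, cutSum_right]
      · rw [ih I h, zero_mul]
      · intro P Q hQ
        rw [if_neg, mul_zero]
        rw [dots_append_eq_dots]
        exact fun h => hQ h.1

/-- With no letter to spare, the first antichain must contain the root that carries the long chain,
hence consists of roots. There are `m ≤ j` roots, so all of them are removed and `j = m`. -/
theorem dotsCoeff_cons_caterpillar (j m : ℕ+) (J I : List ℕ+) (h : J.length = I.length)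
    (hm : m ≤ j) :
    dotsCoeff K (j :: J) (caterpillar (m :: I)) =
      if j = m then dotsCoeff K J (caterpillar I) else 0 := by
  classical
  have hm' : m.natPred + 1 ≤ j := by rw [PNat.natPred_add_one]; exact_mod_cast hm
  have key : ∀ a b, (graft (caterpillar I) empty).cutSum (fun P Q =>
      dotsCoeff K J ((dots a).append P) *
        if (dots b).append Q = dots j then 1 else 0) =
      if b + 1 = j then dotsCoeff K J ((dots a).append (caterpillar I)) else 0 := by
    intro a b
    have h1 := dotsCoeff_eq_zero_of_length_lt K J (1 :: I) (by simp; omega) a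
    have h0 : dots (1 : ℕ+).natPred = empty := rfl
    rw [caterpillar, h0, append] at h1
    rw [cutSum_singleTree, h1, zero_mul, zero_add, cutSum_right]
    · simp [dots_append_eq_dots]
    · intro P Q hQ
      rw [if_neg, mul_zero]
      rw [dots_append_eq_dots]
      exact fun h => hQ h.1
  rw [dotsCoeff_cons, caterpillar, cutSum_dots_append]
  · have := key 0 m.natPred
    simp only [dots, append] at this
    rw [this, PNat.natPred_add_one]
    simp only [PNat.coe_inj, eq_comm]
  · intro a b hab
    rw [key, if_neg]
    omega

theorem dotsCoeff_caterpillar_self (I : List ℕ+) : dotsCoeff K I (caterpillar I) = 1 := by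
  induction I with
  | nil => simp [dotsCoeff_nil, caterpillar]
  | cons m I ih => rw [dotsCoeff_cons_caterpillar K m m I I rfl le_rfl, if_pos rfl, ih]

theorem dotsCoeff_caterpillar_of_lt (I J : List ℕ+) (hl : J.length = I.length) (h : I < J) :
    dotsCoeff K J (caterpillar I) = 0 := by
  induction I generalizing J with
  | nil =>
    rw [List.length_nil, List.length_eq_zero_iff] at hl
    subst hl
    exact absurd h (lt_irrefl _)
  | cons m I ih =>
    cases J with
    | nil => simp at hl
    | cons j J =>
      simp only [List.length_cons, Nat.add_right_cancel_iff] at hl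
      rw [List.cons_lt_cons_iff] at h
      rcases h with h | ⟨rfl, h⟩
      · rw [dotsCoeff_cons_caterpillar K j m J I hl h.le, if_neg h.ne']
      · rw [dotsCoeff_cons_caterpillar K m m J I hl le_rfl, if_pos rfl, ih J hl h]

theorem dotsHom_basis (w : FreeMonoid ℕ+) (F : PlaneForest) :
    (dotsHom K (FreeAlgebra.basisFreeMonoid K ℕ+ w)).1 (HNCK.Y K F) =
      dotsCoeff K w.toList.reverse F := by
  have h : FreeAlgebra.basisFreeMonoid K ℕ+ w = FreeMonoid.lift (FreeAlgebra.ι K) w := by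
    simp [FreeAlgebra.basisFreeMonoid, FreeAlgebra.equivMonoidAlgebraFreeMonoid]
  rw [h, FreeMonoid.lift_apply, map_list_prod, List.map_map, dotsCoeff, List.reverse_reverse]
  have hd : dotsHom K ∘ FreeAlgebra.ι K = fun j : ℕ+ => HNCKDual.X K (dots j) :=
    funext fun n => by simp [dotsHom]
  rw [hd]

/-- Unitriangularity: for a nonzero `x`, evaluation at one well-chosen caterpillar isolates a
nonzero coefficient of `x`. -/
theorem dotsHom_injective : Function.Injective (dotsHom K) := by
  rw [injective_iff_map_eq_zero]
  intro x hx
  by_contra hx0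
  set b := FreeAlgebra.basisFreeMonoid K ℕ+
  have hne : (b.repr x).support.Nonempty := by
    rw [Finsupp.support_nonempty_iff]
    simpa using hx0
  -- The order dual selects a word of maximal length; ties go to the lexicographically least
  -- reversed word. Shorter words, and larger ones of the same length, vanish on the caterpillar of
  -- `w`.
  obtain ⟨w, hw, hmin⟩ := Finset.exists_min_image (b.repr x).support
    (fun w : FreeMonoid ℕ+ => toLex (OrderDual.toDual w.toList.length, w.toList.reverse)) hne
  have hev : (dotsHom K x).1 (HNCK.Y K (caterpillar w.toList.reverse)) = b.repr x w := by
    conv_lhs => rw [← b.linearCombination_repr x, Finsupp.linearCombination_apply, Finsupp.sum,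
      map_sum, HNCKDual.sum_Y]
    rw [Finset.sum_eq_single w]
    · rw [map_smul, HNCKDual.smul_Y, dotsHom_basis, dotsCoeff_caterpillar_self, mul_one]
    · intro v hv hvw
      rw [map_smul, HNCKDual.smul_Y, dotsHom_basis]
      have h := hmin v hv
      rw [Prod.Lex.toLex_le_toLex] at h
      rcases h with h | ⟨h1, h2⟩
      · have h' : v.toList.length < w.toList.length := h
        have := dotsCoeff_eq_zero_of_length_lt K v.toList.reverse w.toList.reverse
          (by simpa using h') 0
        rw [dots, append] at this
        rw [this, mul_zero]
      · have h1' : w.toList.length = v.toList.length := h1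
        rw [dotsCoeff_caterpillar_of_lt K _ _ (by simp [h1']), mul_zero]
        refine lt_of_le_of_ne h2 fun h => hvw ?_
        exact (FreeMonoid.toList.injective (List.reverse_injective h)).symm
    · intro h
      rw [Finsupp.notMem_support_iff.mp h, zero_smul, map_zero]
      rfl
  rw [hx] at hev
  exact Finsupp.mem_support_iff.mp hw hev.symm

theorem toHNCKDual_injective : Function.Injective (toHNCKDual K) := by
  have h : Function.Injective (toHNCKDual K ∘ elementaryHom K) := by
    rw [← AlgHom.coe_comp, toHNCKDual_comp_elementaryHom]
    exact dotsHom_injective K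
  intro x y hxy
  obtain ⟨x, rfl⟩ := elementaryHom_surjective K x
  obtain ⟨y, rfl⟩ := elementaryHom_surjective K y
  exact congrArg _ (h hxy)

end NSym

/-! ### Blocks, boundaries and descents -/

namespace Composition
variable {n : ℕ} (c : Composition n)

theorem index_mono : Monotone c.index := by
  intro i j hij
  by_contra h
  have h1 := c.lt_sizeUpTo_index_succ j
  have h2 := c.sizeUpTo_index_le i
  have h3 := c.monotone_sizeUpTo (show ((c.index j).succ : ℕ) ≤ c.index i by
    rw [Fin.val_succ]; exact not_le.mp h)
  have h4 : (i : ℕ) ≤ j := hij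
  omega

/-- With positions numbered from `0`, the boundary `i + 1` is the gap between the positions `i` and
`i + 1`. -/
theorem mem_boundaries_iff_index_ne {i : ℕ} (h : i + 1 < n) :
    (⟨i + 1, Nat.lt_succ_of_lt h⟩ : Fin (n + 1)) ∈ c.boundaries ↔
      c.index ⟨i, Nat.lt_of_succ_lt h⟩ ≠ c.index ⟨i + 1, h⟩ := by
  have a1 := c.lt_sizeUpTo_index_succ ⟨i, Nat.lt_of_succ_lt h⟩
  have a2 := c.sizeUpTo_index_le ⟨i + 1, h⟩
  have a3 := c.sizeUpTo_index_le ⟨i, Nat.lt_of_succ_lt h⟩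
  have a4 := c.lt_sizeUpTo_index_succ ⟨i + 1, h⟩
  simp only [Fin.val_succ] at a1 a2 a3 a4
  constructor
  · intro hm he
    rw [he] at a1 a3
    obtain ⟨t, -, ht⟩ := Finset.mem_map.mp hm
    have ht' : c.sizeUpTo t = i + 1 := congrArg Fin.val ht
    rcases le_or_gt (t : ℕ) (c.index ⟨i + 1, h⟩) with hle | hlt
    · have := c.monotone_sizeUpTo hle
      omega
    · have := c.monotone_sizeUpTo (show (c.index ⟨i + 1, h⟩ : ℕ) + 1 ≤ t from hlt)
      omega
  · intro hne
    have hlt := lt_of_le_of_ne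
      (c.index_mono (show (⟨i, Nat.lt_of_succ_lt h⟩ : Fin n) ≤ ⟨i + 1, h⟩ from Nat.le_succ i)) hne
    have a5 := c.monotone_sizeUpTo
      (show (c.index ⟨i, Nat.lt_of_succ_lt h⟩ : ℕ) + 1 ≤ c.index ⟨i + 1, h⟩ from hlt)
    refine Finset.mem_map.mpr ⟨(c.index ⟨i + 1, h⟩).castSucc, Finset.mem_univ _, Fin.ext ?_⟩
    change c.sizeUpTo (c.index ⟨i + 1, h⟩) = i + 1
    omega

end Composition

/-- The descents of `σ` are at boundaries of `J` exactly when `σ` increases on the blocks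
of `J`. -/
theorem boundaries_ribbonShape_subset_iff {n : ℕ} (σ : Equiv.Perm (Fin n)) (J : Composition n) :
    (ribbonShape σ).boundaries ⊆ J.boundaries ↔
      ∀ i j, i < j → J.index i = J.index j → σ i < σ j := by
  -- The condition is first expressed for adjacent positions; monotonicity of `index` then lets it
  -- be chained across a whole block.
  have hb : (ribbonShape σ).boundaries ⊆ J.boundaries ↔
      ∀ (i : ℕ) (h : i + 1 < n), J.index ⟨i, Nat.lt_of_succ_lt h⟩ = J.index ⟨i + 1, h⟩ →
        σ ⟨i, Nat.lt_of_succ_lt h⟩ < σ ⟨i + 1, h⟩ := by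
    rw [ribbonShape, CompositionAsSet.toComposition_boundaries]
    constructor
    · intro hs i h he
      by_contra hlt
      refine (J.mem_boundaries_iff_index_ne h).mp (hs ?_) he
      simp only [Finset.mem_filter, Finset.mem_univ, true_and]
      refine Or.inr (Or.inr ⟨i, h, rfl, lt_of_le_of_ne (not_lt.mp hlt) fun h' => ?_⟩)
      have := congrArg Fin.val (σ.injective h')
      simp at this
    · intro hs k hk
      simp only [Finset.mem_filter, Finset.mem_univ, true_and] at hk
      rcases hk with rfl | rfl | ⟨i, h, hk, hd⟩
      · exact J.toCompositionAsSet.zero_mem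
      · exact J.toCompositionAsSet.getLast_mem
      · obtain rfl : k = ⟨i + 1, Nat.lt_succ_of_lt h⟩ := Fin.ext hk
        rw [J.mem_boundaries_iff_index_ne h]
        exact fun he => absurd (hs i h he) hd.not_gt
  rw [hb]
  constructor
  · rintro hs ⟨i, hi⟩ ⟨j, hj⟩ hij he
    have hij' : i + 1 ≤ j := hij
    induction j, hij' using Nat.le_induction with
    | base => exact hs i hj he
    | succ j hij' ih =>
      have h1 := J.index_mono (show (⟨i, hi⟩ : Fin n) ≤ ⟨j, by omega⟩ from Nat.le_of_succ_le hij')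
      have h2 := J.index_mono (show (⟨j, by omega⟩ : Fin n) ≤ ⟨j + 1, hj⟩ from Nat.le_succ j)
      have h3 : J.index ⟨i, hi⟩ = J.index ⟨j, by omega⟩ := le_antisymm h1 (he ▸ h2)
      exact (ih (by omega) hij' h3).trans (hs j hj (h3 ▸ he))
  · exact fun hs i h he => hs _ _ (Nat.lt_succ_self i) he

/-! ### Standardization of labellings -/

namespace PlaneForest

/-- Postorder is a linear extension, so breaking ties by node names respects the forest order. -/
theorem lt_of_below {F : PlaneForest} {i j : Fin F.size} (h : F.Below i j) : i < j := by
  induction h with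
  | root C R i => exact Nat.lt_of_lt_of_le i.2 (Nat.le_add_right _ _)
  | sub C R i j _ ih => exact ih
  | rest C R i j _ ih => exact Nat.add_lt_add_left ih (C.size + 1)

theorem content_eq_map {n : ℕ} (u : Fin n → ℕ) : content u = Finset.univ.val.map u :=
  Multiset.sum_map_singleton (Finset.univ.val.map u) ▸ by rw [Multiset.map_map]; rfl

theorem content_comp_perm {n : ℕ} (u : Fin n → ℕ) (σ : Equiv.Perm (Fin n)) :
    content (u ∘ σ) = content u :=
  Equiv.sum_comp σ fun i => ({u i} : Multiset ℕ)

theorem card_content {n : ℕ} (u : Fin n → ℕ) : (content u).card = n := by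
  simp [content]

theorem eq_of_content_eq_of_monotone {n : ℕ} {u v : Fin n → ℕ} (hu : Monotone u)
    (hv : Monotone v) (h : content u = content v) : u = v := by
  have hc : ∀ w : Fin n → ℕ, content w = (List.ofFn w : Multiset ℕ) := fun w => by
    rw [content_eq_map, Fin.univ_val_map]
  rw [hc, hc, Multiset.coe_eq_coe] at h
  exact List.ofFn_injective
    (h.eq_of_sortedLE (List.sortedLE_ofFn_iff.mpr hu) (List.sortedLE_ofFn_iff.mpr hv))

theorem content_index {n : ℕ} (J : Composition n) :
    content (fun i => (J.index i : ℕ)) = NSym.blockContent J.blocks := by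
  rw [content, ← J.blocksFinEquiv.sum_comp, Fintype.sum_sigma, NSym.blockContent]
  refine Finset.sum_congr rfl fun k _ => ?_
  have h : ∀ j, J.index (J.blocksFinEquiv ⟨k, j⟩) = k := fun j => J.index_embedding k j
  simp only [h, Finset.sum_const, Finset.card_univ, Fintype.card_fin, Multiset.nsmul_singleton]
  rfl

/-- Sorting the nodes by their labels, and by their names when the labels agree, is a bijection
from the nondecreasing labellings with `j_k` labels `k` to the linear extensions whose ribbon
shape is coarser than `J`. -/
theorem card_labellings_eq (F : PlaneForest) (J : Composition F.size) [DecidablePred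
    fun u : Fin F.size → ℕ => content u = NSym.blockContent J.blocks] [DecidablePred
    fun σ : Equiv.Perm (Fin F.size) =>
      F.IsLinearExtension σ ∧ (ribbonShape σ).boundaries ⊆ J.boundaries] :
    ((F.labellings J.length).filter fun u => content u = NSym.blockContent J.blocks).card =
      (Finset.univ.filter fun σ : Equiv.Perm (Fin F.size) =>
        F.IsLinearExtension σ ∧ (ribbonShape σ).boundaries ⊆ J.boundaries).card := by
  -- The only weakly increasing word with the prescribed content. Every admissible labelling sorts
  -- to it, and a linear extension `σ` recovers its labelling as `w ∘ σ⁻¹`.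
  set w : Fin F.size → ℕ := fun i => (J.index i : ℕ) with hw
  have hwm : Monotone w := fun i j hij => J.index_mono hij
  have hstable : ∀ σ : Equiv.Perm (Fin F.size),
      (ribbonShape σ).boundaries ⊆ J.boundaries ↔ ∀ i j, i < j → w i = w j → σ i < σ j := by
    intro σ
    rw [boundaries_ribbonShape_subset_iff]
    simp only [hw, Fin.val_inj]
  have hsort : ∀ u : Fin F.size → ℕ, content u = NSym.blockContent J.blocks →
      u ∘ Tuple.sort u = w := fun u hu =>
    eq_of_content_eq_of_monotone (Tuple.monotone_sort u) hwm
      (by rw [content_comp_perm, hu, content_index])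
  have hwσ : ∀ σ : Equiv.Perm (Fin F.size), (w ∘ ⇑σ⁻¹) ∘ σ = w := fun σ => by
    funext i; simp
  refine Finset.card_bij' (fun u _ => Tuple.sort u) (fun σ _ => w ∘ ⇑σ⁻¹) ?_ ?_ ?_ ?_
  · intro u hu
    simp only [Finset.mem_filter, mem_labellings] at hu
    obtain ⟨⟨-, hnd⟩, hc⟩ := hu
    have hs := hsort u hc
    obtain ⟨hm, hst⟩ := Tuple.eq_sort_iff.mp (rfl : Tuple.sort u = Tuple.sort u)
    simp only [Finset.mem_filter, Finset.mem_univ, true_and]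
    refine ⟨fun i j hij => ?_, (hstable _).mpr fun i j hij he => hst i j hij ?_⟩
    -- If `j` were listed before its descendant `i`, their labels would agree, and stability of the
    -- sort would give `j < i`, against postorder.
    · by_contra hlt
      have hle := not_lt.mp hlt
      have h1 : u j ≤ u i := by simpa using hm hle
      have hne : (Tuple.sort u)⁻¹ j ≠ (Tuple.sort u)⁻¹ i := fun h =>
        (lt_of_below hij).ne' ((Tuple.sort u)⁻¹.injective h)
      have h2 := hst _ _ (lt_of_le_of_ne hle hne) (by simpa using le_antisymm h1 (hnd i j hij))
      simp only [Equiv.Perm.inv_def, Equiv.apply_symm_apply] at h2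
      exact absurd h2 (lt_of_below hij).not_gt
    · rw [← hs] at he
      exact he
  · intro σ hσ
    simp only [Finset.mem_filter, Finset.mem_univ, true_and] at hσ
    simp only [Finset.mem_filter, mem_labellings]
    exact ⟨⟨fun i => (J.index _).2, fun i j hij => hwm (hσ.1 i j hij).le⟩,
      by rw [content_comp_perm, content_index]⟩
  · intro u hu
    simp only [Finset.mem_filter] at hu
    rw [← hsort u hu.2]
    funext i
    simp
  · intro σ hσ
    simp only [Finset.mem_filter, Finset.mem_univ, true_and] at hσ
    -- The stable sort is characterized by sorted values and increasing names within ties; the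
    -- latter is the condition on descents.
    refine (Tuple.eq_sort_iff.mpr ⟨?_, fun i j hij he => ?_⟩).symm
    · rw [hwσ]; exact hwm
    · exact (hstable σ).mp hσ.2 i j hij (by simpa using he)

end PlaneForest

/-! ### Inclusion-exclusion on compositions -/

namespace Composition

theorem boundaries_injective {n : ℕ} :
    Function.Injective (Composition.boundaries : Composition n → Finset (Fin (n + 1))) := by
  intro I J h
  refine (compositionEquiv n).injective (CompositionAsSet.ext ?_)
  exact h

open Classical in
/-- Inclusion-exclusion on the lattice of compositions. -/
theorem sum_neg_one_pow_boundaries {K : Type*} [CommRing K] {n : ℕ} (A I : Composition n) :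
    ∑ J ∈ Finset.univ.filter (fun J : Composition n => J.boundaries ⊆ I.boundaries),
      (-1 : K) ^ (I.length - J.length) * (if A.boundaries ⊆ J.boundaries then 1 else 0) =
    if A = I then 1 else 0 := by
  simp only [mul_ite, mul_one, mul_zero]
  rw [← Finset.sum_filter, Finset.filter_filter]
  -- When `A` is coarser than or equal to `I`, the complement of `J` in `I` runs over all subsets of
  -- `I.boundaries \ A.boundaries`, and its cardinality is the exponent of the sign. Otherwise no
  -- `J` lies between them.
  by_cases hAI : A.boundaries ⊆ I.boundaries
  · have hs : ∑ T ∈ (I.boundaries \ A.boundaries).powerset, (-1 : K) ^ T.card =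
        if A = I then 1 else 0 := by
      have h := congrArg (Int.cast : ℤ → K)
        (Finset.sum_powerset_neg_one_pow_card (x := I.boundaries \ A.boundaries))
      push_cast at h
      rw [h]
      refine if_congr ?_ rfl rfl
      rw [Finset.sdiff_eq_empty_iff_subset]
      exact ⟨fun h => boundaries_injective (hAI.antisymm h), fun h => h ▸ subset_rfl⟩
    rw [← hs]
    refine Finset.sum_bij' (fun J _ => I.boundaries \ J.boundaries)
      (fun T hT => CompositionAsSet.toComposition
        { boundaries := I.boundaries \ T
          zero_mem := Finset.mem_sdiff.mpr ⟨I.toCompositionAsSet.zero_mem, fun h =>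
            (Finset.mem_sdiff.mp (Finset.mem_powerset.mp hT h)).2 A.toCompositionAsSet.zero_mem⟩
          getLast_mem := Finset.mem_sdiff.mpr ⟨I.toCompositionAsSet.getLast_mem, fun h =>
            (Finset.mem_sdiff.mp (Finset.mem_powerset.mp hT h)).2
              A.toCompositionAsSet.getLast_mem⟩ }) ?_ ?_ ?_ ?_ ?_
    · intro J hJ
      simp only [Finset.mem_filter, Finset.mem_univ, true_and] at hJ
      exact Finset.mem_powerset.mpr (Finset.sdiff_subset_sdiff subset_rfl hJ.2)
    · intro T hT
      rw [Finset.mem_powerset] at hT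
      simp only [Finset.mem_filter, Finset.mem_univ, true_and,
        CompositionAsSet.toComposition_boundaries]
      exact ⟨Finset.sdiff_subset, fun x hx =>
        Finset.mem_sdiff.mpr ⟨hAI hx, fun h => (Finset.mem_sdiff.mp (hT h)).2 hx⟩⟩
    · intro J hJ
      simp only [Finset.mem_filter, Finset.mem_univ, true_and] at hJ
      refine boundaries_injective ?_
      rw [CompositionAsSet.toComposition_boundaries]
      exact Finset.sdiff_sdiff_eq_self hJ.1
    · intro T hT
      rw [Finset.mem_powerset] at hT
      rw [CompositionAsSet.toComposition_boundaries]
      exact Finset.sdiff_sdiff_eq_self (hT.trans Finset.sdiff_subset)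
    · intro J hJ
      simp only [Finset.mem_filter, Finset.mem_univ, true_and] at hJ
      rw [Finset.card_sdiff_of_subset hJ.1, card_boundaries_eq_succ_length,
        card_boundaries_eq_succ_length, Nat.add_sub_add_right]
  · rw [if_neg (by rintro rfl; exact hAI subset_rfl), Finset.filter_eq_empty_iff.mpr,
      Finset.sum_empty]
    rintro J - ⟨h1, h2⟩
    exact hAI (h2.trans h1)

end Composition

/-! ### Coefficients of ribbons -/

namespace NSym
variable (K : Type*) [CommRing K]

theorem toHNCKDual_SProd_of_size_ne {n : ℕ} (J : Composition n) (F : PlaneForest)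
    (h : F.size ≠ n) : (toHNCKDual K (SProd K J)).1 (HNCK.Y K F) = 0 := by
  classical
  rw [toHNCKDual_SProd, Finset.filter_eq_empty_iff.mpr, Finset.card_empty, Nat.cast_zero]
  intro u _ hu
  rw [← content_index] at hu
  have := congrArg Multiset.card hu
  rw [card_content, card_content] at this
  exact h this

theorem toHNCKDual_ribbon {n : ℕ} (I : Composition n) (F : PlaneForest) :
    (toHNCKDual K (ribbon K I)).1 (HNCK.Y K F) =
      ∑ J ∈ Finset.univ.filter (fun J : Composition n => J.boundaries ⊆ I.boundaries),
        (-1 : K) ^ (I.length - J.length) * (toHNCKDual K (SProd K J)).1 (HNCK.Y K F) := by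
  classical
  rw [ribbon, map_sum, HNCKDual.sum_Y]
  refine Finset.sum_congr (by congr) fun J _ => ?_
  have h : (-1 : NSym K) ^ (I.length - J.length) * SProd K J =
      (-1 : K) ^ (I.length - J.length) • SProd K J := by
    rw [Algebra.smul_def, map_pow, map_neg, map_one]
  rw [h, map_smul, HNCKDual.smul_Y]

theorem toHNCKDual_ribbon_eq_card {n : ℕ} (I : Composition n) (F : PlaneForest) :
    (toHNCKDual K (ribbon K I)).1 (HNCK.Y K F) =
      (Nat.card {σ : Equiv.Perm (Fin F.size) //
        F.IsLinearExtension σ ∧ (ribbonShape σ).blocks = I.blocks} : K) := by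
  classical
  rw [toHNCKDual_ribbon]
  by_cases hn : F.size = n
  · subst hn
    simp only [toHNCKDual_SProd]
    have hcard : ∀ J : Composition F.size,
        (((F.labellings J.length).filter fun u => content u = blockContent J.blocks).card : K) =
        ∑ σ ∈ Finset.univ.filter (fun σ : Equiv.Perm (Fin F.size) => F.IsLinearExtension σ),
          if (ribbonShape σ).boundaries ⊆ J.boundaries then 1 else 0 := by
      intro J
      rw [card_labellings_eq, Finset.sum_boole, Finset.filter_filter]
    simp only [hcard, Finset.mul_sum]
    -- For each fixed linear extension, the inner alternating sum over `J` is the indicator of shape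
    -- `I`.
    rw [Finset.sum_comm]
    simp only [Composition.sum_neg_one_pow_boundaries]
    rw [Finset.sum_boole, Finset.filter_filter, Nat.card_eq_fintype_card, Fintype.card_subtype]
    simp only [Composition.ext_iff]
  · rw [Finset.sum_eq_zero]
    · have : IsEmpty {σ : Equiv.Perm (Fin F.size) //
          F.IsLinearExtension σ ∧ (ribbonShape σ).blocks = I.blocks} :=
        -- Equal lists of blocks have equal sums, so a matching shape would force `F.size = n`.
        ⟨fun σ => hn (by rw [← (ribbonShape σ.1).blocks_sum, σ.2.2, I.blocks_sum])⟩
      rw [Nat.card_of_isEmpty, Nat.cast_zero]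
    · intro J _
      rw [toHNCKDual_SProd_of_size_ne K J F hn, mul_zero]

end NSym

theorem mainTheorem6 {K : Type*} [CommRing K] :
    Function.Injective (NSym.toHNCKDual K) ∧
    ∀ (n : ℕ) (I : Composition n) (F : PlaneForest),
      (HNCKDual.X K).repr (NSym.toHNCKDual K (NSym.ribbon K I)) F =
        (Nat.card {σ : Equiv.Perm (Fin F.size) //
          F.IsLinearExtension σ ∧ (ribbonShape σ).blocks = I.blocks} : K) :=
  ⟨NSym.toHNCKDual_injective K, fun _ I F => NSym.toHNCKDual_ribbon_eq_card K I F⟩
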